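/- Let $N,D,K$ be integers with $D\ge 1$ and $1\le K\le N$, let $V\in\mathbb{R}^{N\times D}$ have rank $D$, let $\sigma\in\mathbb{R}$, and let $C=\sigma I_N+VV^T$. A \emph{$K$-sparse principal component} of $C$ is a maximizer of $x^TCx$ over the vectors $x\in\mathbb{R}^N$ with $\|x\|=1$ and at most $K$ nonzero entries; $\operatorname{supp}x$ is the set of indices of the nonzero entries of $x$. Put $\Phi=(-\frac{\pi}{2},\frac{\pi}{2}]$ and, for $\phi\in\Phi^{D-1}$, $$c(\phi)=(\sin\phi_1,\ \cos\phi_1\sin\phi_2,\ \dots,\ \cos\phi_1\cdots\cos\phi_{D-2}\sin\phi_{D-1},\ \cos\phi_1\cdots\cos\phi_{D-1})^T\in\mathbb{R}^D$$ (so $c=1$ if $D=1$). A \emph{top-$K$ set at $\phi$} is a set $I\subseteq\{1,\dots,N\}$ with $|I|=K$ that maximizes $\sum_{i\in I}|(Vc(\phi))_i|$ among all sets of $K$ indices. For a priority order $\tau$ (a total order on the indices), the \emph{label} $\mathcal{I}_\tau(V;\phi)$ is the unique top-$K$ set $I$ at $\phi$ such that $i$ precedes $j$ in $\tau$ whenever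 $i\in I$, $j\notin I$ and $|(Vc(\phi))_i|=|(Vc(\phi))_j|$; that is, $\mathcal{I}_\tau$ takes the $K$ largest entries of $|Vc(\phi)|$ and breaks ties by $\tau$. Let $$\mathscr{I}_{\mathrm{tot},\tau}(V)=\{\mathcal{I}_\tau(V;\phi):\phi\in\Phi^{D-1}\}.$$ 1. For every $K$-sparse principal component $x$ of $C$ there are $\phi\in\Phi^{D-1}$ and a top-$K$ set $I$ at $\phi$ with $\operatorname{supp}x\subseteq I$. 2. For every $\tau$ there is a $K$-sparse principal component $x$ of $C$ with $\operatorname{supp}x\subseteq I$ for some $I\in\mathscr{I}_{\mathrm{tot},\tau}(V)$. If no two rows of $V$ are equal up to sign, then for every $\tau$ every $K$-sparse principal component $x$ of $C$ has this property. 3. For every $\tau$, $$|\mathscr{I}_{\mathrm{tot},\tau}(V)|\le\sum_{d=0}^{\lfloor (D-1)/2\rfloor}\binom{N}{D-2d}\binom{D-2d}{\lfloor D/2\rfloor-d}2^{D-1-2d}.$$ 4. For each fixed $D$, the right-hand side in 3, which depends on $N$ and $D$ only, is $O(N^D)$ as $N\to\infty$. -/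

import Mathlib

open scoped Matrix

namespace SparsePCA

noncomputable section

/-- The set of indices of the nonzero entries of a vector. -/
def supp {N : ℕ} (x : EuclideanSpace ℝ (Fin N)) : Finset (Fin N) :=
  {i | x i ≠ 0}

/-- Unit-length vectors of `ℝ^N` with at most `K` nonzero entries. -/
def sparseSphere (N K : ℕ) : Set (EuclideanSpace ℝ (Fin N)) :=
  {x | ‖x‖ = 1 ∧ (supp x).card ≤ K}

/-- `x` is a `K`-sparse principal component of `C`: it maximizes the quadratic form `xᵀ C x`
over the unit vectors with at most `K` nonzero entries. -/
def IsSparsePC {N : ℕ} (C : Matrix (Fin N) (Fin N) ℝ) (K : ℕ)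
    (x : EuclideanSpace ℝ (Fin N)) : Prop :=
  x ∈ sparseSphere N K ∧
    ∀ y ∈ sparseSphere N K, y.ofLp ⬝ᵥ (C *ᵥ y.ofLp) ≤ x.ofLp ⬝ᵥ (C *ᵥ x.ofLp)

/-- The hypercube `Φ^{D-1}` with `Φ = (-π/2, π/2]`. -/
def angles (D : ℕ) : Set (Fin (D - 1) → ℝ) :=
  {φ | ∀ j, φ j ∈ Set.Ioc (-(Real.pi / 2)) (Real.pi / 2)}

/-- The hyperpolar vector
`(sin φ₁, cos φ₁ sin φ₂, …, cos φ₁ ⋯ sin φ_{D-1}, cos φ₁ ⋯ cos φ_{D-1})`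
(for `D = 1` it is the vector with the single entry `1`). -/
def polar {D : ℕ} (φ : Fin (D - 1) → ℝ) : Fin D → ℝ := fun i =>
  (∏ j : Fin (D - 1) with j.val < i.val, Real.cos (φ j)) *
    (if h : i.val < D - 1 then Real.sin (φ ⟨i.val, h⟩) else 1)

/-- `I` is a maximizer of `∑_{i ∈ I} |(V c(φ))_i|` over the index-sets of size `K`, that is, a set
of `K` indices that carry the `K` largest entries of `|V c(φ)|`. -/
def IsTopSet {N D : ℕ} (V : Matrix (Fin N) (Fin D) ℝ) (K : ℕ) (φ : Fin (D - 1) → ℝ)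
    (I : Finset (Fin N)) : Prop :=
  I.card = K ∧ ∀ J : Finset (Fin N), J.card = K →
    ∑ i ∈ J, |(V *ᵥ polar φ) i| ≤ ∑ i ∈ I, |(V *ᵥ polar φ) i|

/-- `I` is the label of the point `φ`: the maximizer of `∑_{i ∈ I} |(V c(φ))_i|` over the index-sets
of size `K`, where equal entries of `|V c(φ)|` are taken in the priority order `τ` (the index with
the smaller value of `τ` first). -/
def IsLabel {N D : ℕ} (V : Matrix (Fin N) (Fin D) ℝ) (K : ℕ) (τ : Equiv.Perm (Fin N))
    (φ : Fin (D - 1) → ℝ) (I : Finset (Fin N)) : Prop :=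
  IsTopSet V K φ I ∧
    ∀ i ∈ I, ∀ j ∉ I, |(V *ᵥ polar φ) i| = |(V *ᵥ polar φ) j| → τ i < τ j

theorem sum_swap {N : ℕ} (w : Fin N → ℝ) (I : Finset (Fin N)) {i j : Fin N} (hi : i ∈ I)
    (hj : j ∉ I) : (insert j (I.erase i)).card = I.card ∧
      ∑ k ∈ insert j (I.erase i), w k = ∑ k ∈ I, w k - w i + w j := by
  have hj' : j ∉ I.erase i := fun h => hj (Finset.mem_of_mem_erase h)
  refine ⟨?_, ?_⟩
  · rw [Finset.card_insert_of_notMem hj', Finset.card_erase_add_one hi]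
  · rw [Finset.sum_insert hj', ← Finset.add_sum_erase I w hi]
    ring

/-- Every point has exactly one label, so that labeling is a function of `φ`. -/
theorem existsUnique_isLabel {N D K : ℕ} (hK : K ≤ N) (V : Matrix (Fin N) (Fin D) ℝ)
    (τ : Equiv.Perm (Fin N)) (φ : Fin (D - 1) → ℝ) : ∃! I, IsLabel V K τ φ I := by
  classical
  set w : Fin N → ℝ := fun i => |(V *ᵥ polar φ) i| with hw
  let F : Finset (Finset (Fin N)) := Finset.powersetCard K Finset.univ
  have hF : F.Nonempty := Finset.powersetCard_nonempty.2 (by simpa using hK)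
  have mF : ∀ J, J ∈ F ↔ J.card = K := fun J => by simp [F]
  obtain ⟨I₀, hI₀, hmax⟩ := F.exists_max_image (fun J => ∑ i ∈ J, w i) hF
  let G : Finset (Finset (Fin N)) := {J ∈ F | ∑ i ∈ J, w i = ∑ i ∈ I₀, w i}
  have hG : G.Nonempty := ⟨I₀, by simp [G, hI₀]⟩
  obtain ⟨I, hI, hmin⟩ := G.exists_min_image (fun J => ∑ i ∈ J, ((τ i : ℕ) : ℝ)) hG
  obtain ⟨hIF, hIs⟩ := Finset.mem_filter.1 hI
  refine ⟨I, ⟨⟨(mF I).1 hIF, fun J hJ => ?_⟩, fun i hi j hj hij => ?_⟩, ?_⟩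
  · have := hmax J ((mF J).2 hJ)
    exact this.trans hIs.ge
  · obtain ⟨hc, hs⟩ := sum_swap w I hi hj
    obtain ⟨-, ht⟩ := sum_swap (fun k => ((τ k : ℕ) : ℝ)) I hi hj
    have hij' : w i = w j := hij
    have h1 := hmin (insert j (I.erase i)) (Finset.mem_filter.2
      ⟨(mF _).2 (hc.trans ((mF I).1 hIF)), by rw [hs, ← hIs, hij']; ring⟩)
    have h2 : ((τ i : ℕ) : ℝ) ≤ ((τ j : ℕ) : ℝ) := by linarith
    have h3 : τ i ≤ τ j := by exact_mod_cast h2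
    refine lt_of_le_of_ne h3 fun h => hj ?_
    rwa [← τ.injective h]
  · rintro J ⟨⟨hJc, hJm⟩, hJt⟩
    by_contra hne
    have hIc : I.card = K := (mF I).1 hIF
    have hJI : ¬ J ⊆ I := fun h => hne (Finset.eq_of_subset_of_card_le h (by omega))
    have hIJ : ¬ I ⊆ J := fun h => hne (Finset.eq_of_subset_of_card_le h (by omega)).symm
    obtain ⟨a, haJ, haI⟩ := Finset.not_subset.1 hJI
    obtain ⟨b, hbI, hbJ⟩ := Finset.not_subset.1 hIJ
    obtain ⟨hc1, hs1⟩ := sum_swap w J haJ hbJ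
    obtain ⟨hc2, hs2⟩ := sum_swap w I hbI haI
    have hJm' := hJm _ (hc1.trans hJc)
    have hI' := hmax _ ((mF _).2 (hc2.trans hIc))
    have h1 : w b ≤ w a := by
      have : ∑ k ∈ insert b (J.erase a), w k ≤ ∑ k ∈ J, w k := hJm'
      linarith
    have h2 : w a ≤ w b := by linarith
    have h3 := hJt a haJ b hbJ (le_antisymm h2 h1)
    obtain ⟨-, ht⟩ := sum_swap (fun k => ((τ k : ℕ) : ℝ)) I hbI haI
    have h4 := hmin (insert a (I.erase b)) (Finset.mem_filter.2
      ⟨(mF _).2 (hc2.trans hIc), by rw [hs2, ← hIs, le_antisymm h1 h2]; ring⟩)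
    have h5 : ((τ b : ℕ) : ℝ) ≤ ((τ a : ℕ) : ℝ) := by linarith
    have h6 : τ b ≤ τ a := by exact_mod_cast h5
    exact absurd h3 (not_lt.2 h6)

/-- The candidate index-sets: all labels of points of `Φ^{D-1}`. -/
def candidates {N D : ℕ} (V : Matrix (Fin N) (Fin D) ℝ) (K : ℕ) (τ : Equiv.Perm (Fin N)) :
    Set (Finset (Fin N)) :=
  {I | ∃ φ ∈ angles D, IsLabel V K τ φ I}

/-- The bound `∑_{d=0}^{⌊(D-1)/2⌋} C(N, D-2d) C(D-2d, ⌊D/2⌋-d) 2^(D-1-2d)`. For `D ≥ 1` none of the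
subtractions is truncated. -/
def candidateBound (N D : ℕ) : ℕ :=
  ∑ d ∈ Finset.range ((D - 1) / 2 + 1),
    N.choose (D - 2 * d) * (D - 2 * d).choose (D / 2 - d) * 2 ^ (D - 1 - 2 * d)

end

end SparsePCA

open SparsePCA

namespace SparsePCA

/-! Catching the optimum. On unit vectors `σI` adds a constant, so an optimal `x` maximizes `‖Vᵀy‖²
/ ‖y‖²` over nonzero `K`-sparse `y`. Put `b = Vᵀx`, `M = ‖b‖² > 0`, and let `w = Vb` be the score.
For `|T| ≤ K`, testing optimality on `w` restricted to `T` and expanding `‖Vᵀ(w|_T) - Mb‖² ≥ 0`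
gives `∑_T w² ≤ M²`, and equality forces `Vᵀ(w|_T) = Mb` (`IsSparsePC.sum_sq_le`). Equality holds on
`supp x`, where `Mx = w`. Since `b` is a nonzero multiple of some `c(φ)`, the top sets at `φ` are
exactly the `K`-sets attaining `M²`. Each of them, however ties are broken, carries the optimal
vector `w|_I / M`. If a top set misses an index of `supp x`, exchanging two indices with equal `w²`
produces two rows that agree up to sign.

Counting. A perturbation of `V` turns the tie-breaking into strict inequalities for all labels at
once, and a rescaling puts the threshold at level `1`; the levels are then moved to generic `r`. For
each label `I`, the inequalities `|(Wc)_i| ≥ r_i` on `I` (with signs fixed) and `|(Wc)_j| ≤ r_j` off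
`I` define a polyhedron without lines, hence with a vertex `c`, at which exactly `D` rows are tight.
The tight set `T`, the signs on `T` up to `c ↦ -c`, and `I ∩ T` recover `I`. As `|I| = K` fixes `|I
∩ T|` once `T` and the signs are known, there are at most `C(N,D) · 2^(D-1) · C(D,⌊D/2⌋)` labels,
which is already the `d = 0` summand of the bound. -/

/-! ### Hyperpolar coordinates. -/

theorem polar_zero {n : ℕ} (φ : Fin (n + 2 - 1) → ℝ) :
    polar (D := n + 2) φ 0 = Real.sin (φ (0 : Fin (n + 1))) := by
  simp [polar]

/-- Peeling off the first angle is what allows induction on `D`. -/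
theorem polar_succ {n : ℕ} (φ : Fin (n + 2 - 1) → ℝ) (i : Fin (n + 1)) :
    polar (D := n + 2) φ i.succ =
      Real.cos (φ (0 : Fin (n + 1))) *
        polar (D := n + 1) (fun j : Fin n => φ (Fin.succ j : Fin (n + 1))) i := by
  have h : ∀ ψ : Fin (n + 1) → ℝ, (∏ j : Fin (n + 1) with j.val < i.val + 1, Real.cos (ψ j)) =
      Real.cos (ψ 0) * ∏ j : Fin n with j.val < i.val, Real.cos (ψ j.succ) := by
    intro ψ
    rw [Finset.prod_filter, Fin.prod_univ_succ, Finset.prod_filter]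
    simp
  have h' := h φ
  unfold polar
  simp only [Fin.val_succ, Nat.add_one_sub_one]
  rw [← mul_assoc]
  congr 1
  by_cases hi : i.val < n <;> simp [hi]

theorem polar_ne_zero {D : ℕ} (hD : 1 ≤ D) (φ : Fin (D - 1) → ℝ) : polar φ ≠ 0 := by
  obtain ⟨n, rfl⟩ : ∃ n, D = n + 1 := ⟨D - 1, by omega⟩
  induction n with
  | zero =>
    intro h
    have := congrFun h 0
    simp [polar] at this
  | succ n ih =>
    intro h
    have h0 := congrFun h 0
    rw [polar_zero] at h0
    refine ih (by omega) (fun j : Fin n => φ (Fin.succ j : Fin (n + 1))) (funext fun i => ?_)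
    have h1 := congrFun h i.succ
    rw [polar_succ] at h1
    refine (mul_eq_zero.1 h1).resolve_left fun hc => ?_
    have := Real.sin_sq_add_cos_sq (φ (0 : Fin (n + 1)))
    rw [hc, h0] at this
    simp at this

/-- The hyperpolar vectors represent every direction up to sign. -/
theorem exists_eq_smul_polar {D : ℕ} (hD : 1 ≤ D) (b : Fin D → ℝ) (hb : b ≠ 0) :
    ∃ φ ∈ angles D, ∃ a : ℝ, a ≠ 0 ∧ b = a • polar φ := by
  obtain ⟨n, rfl⟩ : ∃ n, D = n + 1 := ⟨D - 1, by omega⟩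
  have hpi := Real.pi_pos
  induction n with
  | zero =>
    refine ⟨fun j => j.elim0, fun j => j.elim0, b 0, fun h => hb ?_, ?_⟩
    · ext i
      rw [show i = 0 from Fin.fin_one_eq_zero i, h]; rfl
    · ext i
      rw [show i = 0 from Fin.fin_one_eq_zero i]
      simp [polar]
  | succ n ih =>
    -- If the tail vanishes, the first angle `π/2` kills the tail of the hyperpolar vector.
    -- Otherwise the tail is `a • polar ψ`, and `arctan (b 0 / a)` with scale `a / cos` matches both
    -- parts. The scale may be negative, since the angles cover only half of the sphere.
    by_cases hb' : (fun i : Fin (n + 1) => b i.succ) = 0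
    · let φ : Fin (n + 1) → ℝ := Fin.cons (Real.pi / 2) 0
      refine ⟨φ, ?_, b 0, fun h => hb ?_, ?_⟩
      · intro j
        refine Fin.cases ?_ (fun k => ?_) (j : Fin (n + 1))
        · exact ⟨by simp [φ]; linarith, by simp [φ]⟩
        · exact ⟨by simp [φ, hpi], by simp [φ]; linarith⟩
      · ext i
        refine Fin.cases h (fun k => congrFun hb' k) i
      · ext i
        refine Fin.cases ?_ (fun k => ?_) i
        · rw [Pi.smul_apply, polar_zero]; simp [φ]
        · rw [Pi.smul_apply, polar_succ]
          have := congrFun hb' k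
          simp only [Pi.zero_apply] at this
          simp [φ, this]
    · obtain ⟨ψ, hψ, a, ha, hab⟩ := ih (by omega) _ hb'
      have hcos := Real.cos_arctan_pos (b 0 / a)
      let φ : Fin (n + 1) → ℝ := Fin.cons (Real.arctan (b 0 / a)) ψ
      refine ⟨φ, ?_, a / Real.cos (Real.arctan (b 0 / a)), div_ne_zero ha hcos.ne', ?_⟩
      · intro j
        refine Fin.cases ?_ (fun k => ?_) (j : Fin (n + 1))
        · exact ⟨Real.neg_pi_div_two_lt_arctan _, (Real.arctan_lt_pi_div_two _).le⟩
        · exact hψ k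
      · ext i
        refine Fin.cases ?_ (fun k => ?_) i
        · rw [Pi.smul_apply, polar_zero, smul_eq_mul, div_mul_eq_mul_div, mul_div_assoc]
          change b 0 = a * (Real.sin (Real.arctan (b 0 / a)) / Real.cos (Real.arctan (b 0 / a)))
          rw [← Real.tan_eq_sin_div_cos, Real.tan_arctan]
          field_simp
        · rw [Pi.smul_apply, polar_succ, smul_eq_mul]
          change b k.succ = a / Real.cos (Real.arctan (b 0 / a)) *
            (Real.cos (Real.arctan (b 0 / a)) * polar (D := n + 1) ψ k)
          rw [← mul_assoc, div_mul_cancel₀ _ hcos.ne']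
          exact congrFun hab k

/-! ### Vertices, generic levels and the count of separated sets. -/

/-- A nonempty polyhedron without lines has a vertex. -/
theorem exists_polyhedron_vertex {E ι : Type*} [AddCommGroup E] [Module ℝ E] [Fintype ι]
    (A : ι → E →ₗ[ℝ] ℝ) (b : ι → ℝ) (hA : ∀ u, (∀ m, A m u = 0) → u = 0)
    (hne : ∃ c, ∀ m, A m c ≤ b m) :
    ∃ c, (∀ m, A m c ≤ b m) ∧ ∀ u, (∀ m, A m c = b m → A m u = 0) → u = 0 := by
  classical
  -- A feasible point with the largest number of tight constraints is a vertex.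
  let t : E → Finset ι := fun c => {m | A m c = b m}
  let P : ℕ → Prop := fun k => ∃ c, (∀ m, A m c ≤ b m) ∧ (t c).card = k
  obtain ⟨c₀, hc₀⟩ := hne
  have hbd : ∀ k, P k → k ≤ Fintype.card ι := by
    rintro k ⟨c, -, rfl⟩
    exact Finset.card_le_univ _
  have hP : P (Nat.findGreatest P (Fintype.card ι)) :=
    Nat.findGreatest_spec (hbd _ ⟨c₀, hc₀, rfl⟩) ⟨c₀, hc₀, rfl⟩
  obtain ⟨c, hc, hck⟩ := hP
  have key : ∀ u, (∀ m, A m c = b m → A m u = 0) → ∀ m, A m u ≤ 0 := by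
    intro u hu m
    by_contra! hm
    let S : Finset ι := {m | 0 < A m u}
    obtain ⟨m₀, hm₀, hmin⟩ := S.exists_min_image (fun m => (b m - A m c) / A m u)
      ⟨m, by simpa [S] using hm⟩
    have hm₀' : 0 < A m₀ u := by simpa [S] using hm₀
    -- Ratio test: the step along `u` to the first constraint hit. The old tight constraints survive
    -- and `m₀` becomes tight, against maximality.
    set l := (b m₀ - A m₀ c) / A m₀ u with hl
    have hl0 : 0 ≤ l := div_nonneg (sub_nonneg.2 (hc m₀)) hm₀'.le
    have hfeas : ∀ m, A m (c + l • u) ≤ b m := by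
      intro m
      rw [map_add, map_smul, smul_eq_mul]
      rcases le_or_gt (A m u) 0 with h | h
      · nlinarith [hc m]
      · have := hmin m (by simpa [S] using h)
        rw [le_div_iff₀ h] at this
        linarith
    have hlt : t c ⊂ t (c + l • u) := by
      refine Finset.ssubset_iff_of_subset ?_ |>.2 ⟨m₀, ?_, ?_⟩
      · intro m hm
        simp only [t, Finset.mem_filter, Finset.mem_univ, true_and] at hm ⊢
        rw [map_add, map_smul, hu m hm, smul_zero, add_zero, hm]
      · simp only [t, Finset.mem_filter, Finset.mem_univ, true_and]
        rw [map_add, map_smul, smul_eq_mul, hl, div_mul_cancel₀ _ hm₀'.ne']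
        ring
      · simp only [t, Finset.mem_filter, Finset.mem_univ, true_and]
        exact fun h => hm₀'.ne' (hu _ h)
    have h1 := Finset.card_lt_card hlt
    have h2 : P (t (c + l • u)).card := ⟨_, hfeas, rfl⟩
    have h3 := Nat.le_findGreatest (hbd _ h2) h2
    omega
  refine ⟨c, hc, fun u hu => hA u fun m => le_antisymm (key u hu m) ?_⟩
  have := key (-u) (fun m hm => by rw [map_neg, hu m hm, neg_zero]) m
  rw [map_neg] at this
  linarith

/-- Finitely many proper subspaces do not cover a nonempty open set. -/
theorem exists_mem_open_forall_notMem {n : ℕ} {ι : Type*} [Finite ι]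
    (p : ι → Submodule ℝ (Fin n → ℝ)) (hp : ∀ i, p i ≠ ⊤) {U : Set (Fin n → ℝ)}
    (hU : IsOpen U) (hne : U.Nonempty) : ∃ x ∈ U, ∀ i, x ∉ p i := by
  by_contra! h
  have h0 : MeasureTheory.volume (⋃ i, (p i : Set (Fin n → ℝ))) = 0 :=
    MeasureTheory.measure_iUnion_null fun i =>
      MeasureTheory.Measure.addHaar_submodule _ _ (hp i)
  refine (hU.measure_pos MeasureTheory.volume hne).ne'
    (MeasureTheory.measure_mono_null (fun x hx => ?_) h0)
  obtain ⟨i, hi⟩ := h x hx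
  exact Set.mem_iUnion.2 ⟨i, hi⟩

/-- `c` separates `I` from its complement with respect to the levels `r`. -/
def Separates {N D : ℕ} (V : Matrix (Fin N) (Fin D) ℝ) (r : Fin N → ℝ) (I : Finset (Fin N))
    (c : Fin D → ℝ) : Prop :=
  (∀ i ∈ I, r i ≤ |(V *ᵥ c) i|) ∧ ∀ j ∉ I, |(V *ᵥ c) j| ≤ r j

theorem Separates.neg {N D : ℕ} {V : Matrix (Fin N) (Fin D) ℝ} {r : Fin N → ℝ}
    {I : Finset (Fin N)} {c : Fin D → ℝ} (h : Separates V r I c) : Separates V r I (-c) := by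
  simpa [Separates, Matrix.mulVec_neg] using h

/-- The condition `r i ≤ |(V *ᵥ c) i|` is not convex, but it becomes linear once the sign of row `i`
is frozen at its value at `c₀`, which is nonzero because `r i > 0`. Injectivity of `V` excludes
lines. -/
theorem Separates.exists_vertex {N D : ℕ} {V : Matrix (Fin N) (Fin D) ℝ}
    (hV : ∀ u, V *ᵥ u = 0 → u = 0) {r : Fin N → ℝ} (hr : ∀ i, 0 < r i) {I : Finset (Fin N)}
    {c₀ : Fin D → ℝ} (h₀ : Separates V r I c₀) :
    ∃ c, Separates V r I c ∧
      ∀ u, (∀ i, |(V *ᵥ c) i| = r i → (V *ᵥ u) i = 0) → u = 0 := by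
  classical
  let s : Fin N → ℝ := fun i => SignType.sign ((V *ᵥ c₀) i)
  -- The Boolean selects one of the two sides of `|·| ≤ r` off `I`; on `I` both copies are the same
  -- constraint.
  let a : Fin N × Bool → ℝ := fun m => if m.1 ∈ I then -s m.1 else if m.2 then 1 else -1
  let R : Fin N → (Fin D → ℝ) →ₗ[ℝ] ℝ := fun i => (LinearMap.proj i).comp V.mulVecLin
  have hR : ∀ i c, R i c = (V *ᵥ c) i := fun i c => rfl
  have hs : ∀ i ∈ I, s i * (V *ᵥ c₀) i = |(V *ᵥ c₀) i| := fun i _ => sign_mul_self _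
  have hs1 : ∀ i ∈ I, |s i| = 1 := by
    intro i hi
    have : (V *ᵥ c₀) i ≠ 0 := by
      rw [← abs_pos]
      exact (hr i).trans_le (h₀.1 i hi)
    rcases this.lt_or_gt with h | h <;> simp [s, h]
  obtain ⟨c, hc, hv⟩ := exists_polyhedron_vertex (fun m => a m • R m.1)
    (fun m => if m.1 ∈ I then -r m.1 else r m.1) (fun u hu => hV u (funext fun i => by
      have := hu (i, true)
      simp only [a, LinearMap.smul_apply, hR, smul_eq_mul, if_true] at this
      rcases mul_eq_zero.1 this with h | h
      · split_ifs at h with hi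
        · have := hs1 i hi
          rw [neg_eq_zero.1 h] at this
          simp at this
        · simp at h
      · exact h)) ⟨c₀, fun m => by
        by_cases hi : m.1 ∈ I
        · simp only [a, LinearMap.smul_apply, hR, smul_eq_mul, hi, if_true, neg_mul]
          rw [hs _ hi]
          exact neg_le_neg (h₀.1 _ hi)
        · have := abs_le.1 (h₀.2 _ hi)
          simp only [a, LinearMap.smul_apply, hR, smul_eq_mul, hi, if_false]
          split_ifs <;> linarith⟩
  have hsI : ∀ i ∈ I, r i ≤ s i * (V *ᵥ c) i := by
    intro i hi
    have := hc (i, true)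
    simp only [a, LinearMap.smul_apply, hR, smul_eq_mul, hi, if_true] at this
    linarith
  refine ⟨c, ⟨fun i hi => ?_, fun j hj => ?_⟩, fun u hu => hv u fun m hm => ?_⟩
  · refine (hsI i hi).trans ((le_abs_self _).trans ?_)
    rw [abs_mul, hs1 i hi, one_mul]
  · have h1 := hc (j, true)
    have h2 := hc (j, false)
    simp only [a, LinearMap.smul_apply, hR, smul_eq_mul, hj, if_false, if_true,
      Bool.false_eq_true] at h1 h2
    exact abs_le.2 ⟨by linarith, by linarith⟩
  · have : (V *ᵥ u) m.1 = 0 := by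
      apply hu
      have hrm := hr m.1
      by_cases hi : m.1 ∈ I
      · simp only [a, LinearMap.smul_apply, hR, smul_eq_mul, hi, if_true, neg_mul, neg_inj] at hm
        rw [← one_mul |_|, ← hs1 _ hi, ← abs_mul, hm, abs_of_pos hrm]
      · simp only [a, LinearMap.smul_apply, hR, smul_eq_mul, hi, if_false] at hm
        split_ifs at hm
        · rw [one_mul] at hm; rw [hm, abs_of_pos hrm]
        · rw [← abs_neg, ← neg_one_mul, hm, abs_of_pos hrm]
    simp only [LinearMap.smul_apply, hR, this, smul_zero]

/-- A vector of levels that no point attains on more than `D` rows. -/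
def GenericLevels {N D : ℕ} (V : Matrix (Fin N) (Fin D) ℝ) (r : Fin N → ℝ) : Prop :=
  ∀ (c : Fin D → ℝ) (T : Finset (Fin N)), (∀ t ∈ T, |(V *ᵥ c) t| = r t) → T.card ≤ D

/-- If `|(Vc)_t| = r_t` on a set `T` with more than `D` elements, then `r` restricted to `T`, after
sign changes, lies in the image of a linear map from `ℝ^D` to `ℝ^T`. This is a proper subspace
condition on `r`, one for each of finitely many pairs of `T` and signs. -/
theorem exists_genericLevels {N D : ℕ} (V : Matrix (Fin N) (Fin D) ℝ) {U : Set (Fin N → ℝ)}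
    (hU : IsOpen U) (hne : U.Nonempty) : ∃ r ∈ U, GenericLevels V r := by
  classical
  let ι := {q : Finset (Fin N) × (Fin N → SignType) // D < q.1.card ∧ ∀ i, q.2 i ≠ 0}
  let L : (q : ι) → (Fin D → ℝ) →ₗ[ℝ] (q.1.1 → ℝ) := fun q =>
    LinearMap.pi fun t => (LinearMap.proj t.1).comp V.mulVecLin
  let S : (q : ι) → (Fin N → ℝ) →ₗ[ℝ] (q.1.1 → ℝ) := fun q =>
    LinearMap.pi fun t => ((q.1.2 t.1 : SignType) : ℝ) • LinearMap.proj t.1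
  have hp : ∀ q, (L q).range.comap (S q) ≠ ⊤ := by
    intro q h
    have hsurj : Function.Surjective (L q) := by
      intro y
      have hz : ∀ i, ((q.1.2 i : SignType) : ℝ) * ((q.1.2 i : SignType) : ℝ) = 1 := by
        intro i
        have := q.2.2 i
        cases hq : q.1.2 i <;> simp_all
      let x : Fin N → ℝ := fun i => if hi : i ∈ q.1.1 then (q.1.2 i : ℝ) * y ⟨i, hi⟩ else 0
      have hx : x ∈ (L q).range.comap (S q) := h ▸ Submodule.mem_top
      obtain ⟨c, hc⟩ := hx
      refine ⟨c, hc.trans (funext fun t => ?_)⟩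
      simp only [S, LinearMap.pi_apply, LinearMap.smul_apply, LinearMap.proj_apply, x, t.2,
        smul_eq_mul, dif_pos]
      rw [← mul_assoc, hz, one_mul]
    have := LinearMap.finrank_le_finrank_of_surjective hsurj
    simp only [Module.finrank_fintype_fun_eq_card, Fintype.card_coe, Fintype.card_fin] at this
    have := q.2.1
    omega
  obtain ⟨r, hr, hgen⟩ := exists_mem_open_forall_notMem (ι := ι) _ hp hU hne
  refine ⟨r, hr, fun c T hT => ?_⟩
  by_contra! hcard
  let σ : Fin N → SignType := fun i => if 0 ≤ (V *ᵥ c) i then 1 else -1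
  refine hgen ⟨(T, σ), hcard, fun i => ?_⟩ ⟨c, funext fun t => ?_⟩
  · simp only [σ]; split_ifs <;> simp
  · simp only [S, L, LinearMap.pi_apply, LinearMap.smul_apply, LinearMap.proj_apply, σ,
      LinearMap.comp_apply, Matrix.mulVecLin_apply, smul_eq_mul]
    rw [← hT t.1 t.2]
    split_ifs with h
    · rw [abs_of_nonneg h]; simp
    · rw [abs_of_neg (not_le.1 h)]; simp

/-- Genericity bounds the tight rows from above, and at a vertex the tight rows determine `u`, so
there are at least `D`. -/
theorem card_eq_of_isVertex {N D : ℕ} {V : Matrix (Fin N) (Fin D) ℝ} {r : Fin N → ℝ}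
    (hgen : GenericLevels V r) {c : Fin D → ℝ} {T : Finset (Fin N)}
    (hT : ∀ i, i ∈ T ↔ |(V *ᵥ c) i| = r i) (hv : ∀ u, (∀ i ∈ T, (V *ᵥ u) i = 0) → u = 0) :
    T.card = D := by
  refine le_antisymm (hgen c T fun t ht => (hT t).1 ht) ?_
  let L : (Fin D → ℝ) →ₗ[ℝ] (T → ℝ) :=
    LinearMap.pi fun t => (LinearMap.proj t.1).comp V.mulVecLin
  have hL : Function.Injective L := by
    rw [injective_iff_map_eq_zero]
    exact fun u hu => hv u fun i hi => congrFun hu ⟨i, hi⟩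
  have := LinearMap.finrank_le_finrank_of_injective hL
  simpa only [Module.finrank_fintype_fun_eq_card, Fintype.card_coe, Fintype.card_fin] using this

/-- The number of `K`-sets that can be separated at generic levels. -/
theorem ncard_separated_le {N D : ℕ} (hD : 1 ≤ D) (K : ℕ) {V : Matrix (Fin N) (Fin D) ℝ}
    (hV : ∀ u, V *ᵥ u = 0 → u = 0) {r : Fin N → ℝ} (hr : ∀ i, 0 < r i)
    (hgen : GenericLevels V r) (𝓛 : Set (Finset (Fin N)))
    (h𝓛 : ∀ I ∈ 𝓛, I.card = K ∧ ∃ c, Separates V r I c) :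
    𝓛.ncard ≤ N.choose D * D.choose (D / 2) * 2 ^ (D - 1) := by
  classical
  -- `P ⊆ E T` records the negative tight rows. The least row of `T` is left out, as `c ↦ -c` can
  -- make its entry nonnegative; this saves the factor `2`.
  let E : Finset (Fin N) → Finset (Fin N) := fun T =>
    if h : T.Nonempty then T.erase (T.min' h) else ∅
  let A : Finset (Fin N) → Finset (Fin N) → Finset (Fin N) := fun T P =>
    {i | i ∉ T ∧ ∃ c, (∀ t ∈ T, (V *ᵥ c) t = if t ∈ P then -r t else r t) ∧ r i < |(V *ᵥ c) i|}
  let F : Finset (Finset (Fin N)) := (Finset.powersetCard D Finset.univ).biUnion fun T =>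
    (E T).powerset.biUnion fun P =>
      (Finset.powersetCard (K - (A T P).card) T).image fun S => A T P ∪ S
  have hF : F.card ≤ N.choose D * D.choose (D / 2) * 2 ^ (D - 1) := by
    have h1 : F.card ≤ (Finset.powersetCard D (Finset.univ : Finset (Fin N))).card *
        (2 ^ (D - 1) * D.choose (D / 2)) := by
      refine Finset.card_biUnion_le_card_mul _ _ _ fun T hT => ?_
      have hTc : T.card = D := (Finset.mem_powersetCard.1 hT).2
      have hTn : T.Nonempty := Finset.card_pos.1 (by omega)
      have hE : (E T).powerset.card = 2 ^ (D - 1) := by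
        rw [Finset.card_powerset]
        simp only [E, dif_pos hTn]
        rw [Finset.card_erase_of_mem (Finset.min'_mem _ _), hTc]
      rw [← hE]
      refine Finset.card_biUnion_le_card_mul _ _ _ fun P _ => ?_
      refine Finset.card_image_le.trans ?_
      rw [Finset.card_powersetCard, hTc]
      exact Nat.choose_le_middle _ _
    rw [Finset.card_powersetCard, Finset.card_univ, Fintype.card_fin] at h1
    refine h1.trans_eq (by ring)
  rw [← Set.ncard_coe_finset] at hF
  refine (Set.ncard_le_ncard (fun I hI => ?_) (Finset.finite_toSet F)).trans hF
  obtain ⟨hIK, c₀, hc₀⟩ := h𝓛 I hI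
  obtain ⟨c₁, hc₁, hv₁⟩ := hc₀.exists_vertex hV hr
  set T : Finset (Fin N) := {i | |(V *ᵥ c₁) i| = r i} with hTdef
  have hT₁ : ∀ i, i ∈ T ↔ |(V *ᵥ c₁) i| = r i := fun i => by simp [hTdef]
  have hv : ∀ u, (∀ i ∈ T, (V *ᵥ u) i = 0) → u = 0 := fun u hu =>
    hv₁ u fun i hi => hu i ((hT₁ i).2 hi)
  have hTc : T.card = D := card_eq_of_isVertex hgen hT₁ hv
  have hTn : T.Nonempty := Finset.card_pos.1 (by omega)
  obtain ⟨c, hc, hT, hpos⟩ : ∃ c, Separates V r I c ∧ (∀ i, i ∈ T ↔ |(V *ᵥ c) i| = r i) ∧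
      0 ≤ (V *ᵥ c) (T.min' hTn) := by
    rcases le_total 0 ((V *ᵥ c₁) (T.min' hTn)) with h | h
    · exact ⟨c₁, hc₁, hT₁, h⟩
    · refine ⟨-c₁, hc₁.neg, fun i => ?_, ?_⟩
      · rw [Matrix.mulVec_neg, Pi.neg_apply, abs_neg]; exact hT₁ i
      · rw [Matrix.mulVec_neg, Pi.neg_apply]; linarith
  set P : Finset (Fin N) := {t ∈ T | (V *ᵥ c) t < 0} with hP
  have hsign : ∀ t ∈ T, (V *ᵥ c) t = if t ∈ P then -r t else r t := by
    intro t ht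
    have htr := (hT t).1 ht
    simp only [hP, Finset.mem_filter, ht, true_and]
    split_ifs with h
    · rw [← htr, abs_of_neg h, neg_neg]
    · rw [← htr, abs_of_nonneg (not_lt.1 h)]
  have hA : ∀ i, i ∈ A T P ↔ i ∈ I ∧ i ∉ T := by
    intro i
    simp only [A, Finset.mem_filter, Finset.mem_univ, true_and]
    constructor
    -- Two points with the same signed values on `T` coincide by the vertex property.
    · rintro ⟨hiT, c', hc', hi⟩
      have hcc : c' - c = 0 := hv _ fun t ht => by
        rw [Matrix.mulVec_sub, Pi.sub_apply, hc' t ht, hsign t ht, sub_self]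
      rw [sub_eq_zero.1 hcc] at hi
      refine ⟨?_, hiT⟩
      by_contra hiI
      exact absurd (hc.2 i hiI) (not_le.2 hi)
    · rintro ⟨hiI, hiT⟩
      exact ⟨hiT, c, hsign, lt_of_le_of_ne (hc.1 i hiI) fun h => hiT ((hT i).2 h.symm)⟩
  have hAI : A T P = I \ T := by
    ext i; rw [hA, Finset.mem_sdiff]
  simp only [F, Finset.coe_biUnion, Set.mem_iUnion, Finset.mem_coe, Finset.mem_image,
    Finset.mem_powersetCard, Finset.mem_powerset]
  refine ⟨T, ⟨Finset.subset_univ _, hTc⟩, P, ?_, I ∩ T, ⟨Finset.inter_subset_right, ?_⟩, ?_⟩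
  · intro t ht
    obtain ⟨htT, hlt⟩ := Finset.mem_filter.1 ht
    simp only [E, dif_pos hTn, Finset.mem_erase]
    refine ⟨?_, htT⟩
    rintro rfl
    exact absurd hpos (not_le.2 hlt)
  · have := Finset.card_sdiff_add_card_inter I T
    rw [hAI]; omega
  · rw [hAI, Finset.sdiff_union_inter]

/-! ### Perturbing ties into strict inequalities, and the bound on the labels. -/

open Filter Topology

/-- `J \ I` and `I \ J` have equal size, so any bijection between them compares the two sums term by
term. -/
theorem sum_le_sum_of_exchange {N : ℕ} (f : Fin N → ℝ) {I J : Finset (Fin N)}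
    (h : ∀ i ∈ I, ∀ j ∉ I, f j ≤ f i) (hJ : J.card = I.card) :
    ∑ i ∈ J, f i ≤ ∑ i ∈ I, f i := by
  classical
  have hcard : (J \ I).card = (I \ J).card := by
    have h1 := Finset.card_sdiff_add_card_inter I J
    have h2 := Finset.card_sdiff_add_card_inter J I
    rw [Finset.inter_comm] at h2
    omega
  obtain ⟨e⟩ : Nonempty (↥(J \ I) ≃ ↥(I \ J)) :=
    ⟨Fintype.equivOfCardEq (by rw [Fintype.card_coe, Fintype.card_coe, hcard])⟩
  have hle : ∑ i ∈ J \ I, f i ≤ ∑ i ∈ I \ J, f i := by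
    rw [← Finset.sum_coe_sort (J \ I), ← Finset.sum_coe_sort (I \ J), ← e.sum_comp]
    exact Finset.sum_le_sum fun j _ => h _ (Finset.mem_sdiff.1 (e j).2).1 _
      (Finset.mem_sdiff.1 j.2).2
  rw [← Finset.sum_inter_add_sum_sdiff J I, ← Finset.sum_inter_add_sum_sdiff I J,
    Finset.inter_comm I J]
  linarith

theorem isTopSet_iff {N D : ℕ} {V : Matrix (Fin N) (Fin D) ℝ} {K : ℕ} {φ : Fin (D - 1) → ℝ}
    {I : Finset (Fin N)} : IsTopSet V K φ I ↔ I.card = K ∧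
      ∀ i ∈ I, ∀ j ∉ I, |(V *ᵥ polar φ) j| ≤ |(V *ᵥ polar φ) i| := by
  refine ⟨fun ⟨hc, h⟩ => ⟨hc, fun i hi j hj => ?_⟩, fun ⟨hc, h⟩ => ⟨hc, fun J hJ =>
    sum_le_sum_of_exchange _ h (hJ.trans hc.symm)⟩⟩
  obtain ⟨h1, h2⟩ := sum_swap (fun k => |(V *ᵥ polar φ) k|) I hi hj
  have := h _ (h1.trans hc)
  linarith

/-- Strict inequalities persist by continuity. For a nonzero tie the gain `ε (t - s) |y|` beats the
error `ε² (t + s) |k|`; for a tie at zero only the `ε²` term is left, and it decides. -/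
theorem eventually_abs_lt {x y s t k : ℝ} (hs : 0 ≤ s) (hk : k ≠ 0)
    (h : |x| < |y| ∨ |x| = |y| ∧ s < t) :
    ∀ᶠ ε in 𝓝[>] (0 : ℝ),
      |(1 + ε * s) * x + ε ^ 2 * s * k| < |(1 + ε * t) * y + ε ^ 2 * t * k| := by
  rcases h with h | ⟨h, hst⟩
  · have hf : Continuous fun ε : ℝ => |(1 + ε * s) * x + ε ^ 2 * s * k| := by fun_prop
    have hg : Continuous fun ε : ℝ => |(1 + ε * t) * y + ε ^ 2 * t * k| := by fun_prop
    refine nhdsWithin_le_nhds (hf.continuousAt.eventually_lt hg.continuousAt ?_)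
    simpa using h
  · have hk' := abs_pos.2 hk
    rcases (abs_nonneg y).eq_or_lt with hy | hy
    · have hx0 : x = 0 := abs_eq_zero.1 (h.trans hy.symm)
      have hy0 : y = 0 := abs_eq_zero.1 hy.symm
      filter_upwards [self_mem_nhdsWithin] with ε hε
      have hε' : 0 < ε := hε
      rw [hx0, hy0, mul_zero, zero_add, mul_zero, zero_add, abs_mul, abs_mul, abs_mul, abs_mul,
        abs_of_nonneg hs, abs_of_pos (hs.trans_lt hst)]
      have : 0 < |ε ^ 2| := by positivity
      gcongr
    · have hf : Continuous fun ε : ℝ => ε * (t + s) * |k| := by fun_prop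
      have hev : ∀ᶠ ε in 𝓝[>] (0 : ℝ), ε * (t + s) * |k| < |y| * (t - s) := by
        refine nhdsWithin_le_nhds (hf.continuousAt.eventually_lt continuousAt_const ?_)
        simpa using mul_pos hy (sub_pos.2 hst)
      filter_upwards [self_mem_nhdsWithin, hev] with ε hε h1
      have hε' : 0 < ε := hε
      have ht := hs.trans_lt hst
      have h2 : |(1 + ε * s) * x + ε ^ 2 * s * k| ≤ (1 + ε * s) * |y| + ε ^ 2 * s * |k| := by
        refine (abs_add_le _ _).trans_eq ?_
        rw [abs_mul, abs_mul, h, abs_of_nonneg (by positivity : 0 ≤ 1 + ε * s),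
          abs_of_nonneg (by positivity : 0 ≤ ε ^ 2 * s)]
      have h3 : (1 + ε * t) * |y| - ε ^ 2 * t * |k| ≤ |(1 + ε * t) * y + ε ^ 2 * t * k| := by
        have := abs_sub_abs_le_abs_sub ((1 + ε * t) * y) (-(ε ^ 2 * t * k))
        rw [sub_neg_eq_add, abs_neg, abs_mul, abs_mul,
          abs_of_nonneg (by positivity : 0 ≤ 1 + ε * t),
          abs_of_nonneg (by positivity : 0 ≤ ε ^ 2 * t)] at this
        exact this
      have h4 := mul_lt_mul_of_pos_left h1 hε'
      nlinarith

theorem mulVec_injective_of_rank {N D : ℕ} {V : Matrix (Fin N) (Fin D) ℝ} (hV : V.rank = D)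
    (u : Fin D → ℝ) (hu : V *ᵥ u = 0) : u = 0 := by
  have h := V.mulVecLin.finrank_range_add_finrank_ker
  have h' : Module.finrank ℝ V.mulVecLin.range = D := hV
  rw [h', Module.finrank_fintype_fun_eq_card, Fintype.card_fin] at h
  have h0 : V.mulVecLin.ker = ⊥ := Submodule.finrank_eq_zero.1 (by omega)
  have : u ∈ V.mulVecLin.ker := hu
  rwa [h0, Submodule.mem_bot] at this

/-- Injectivity is nonvanishing of the Gram determinant, an open condition. -/
theorem eventually_mulVec_injective {N D : ℕ} {W : ℝ → Matrix (Fin N) (Fin D) ℝ}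
    (hW : Continuous W) (h0 : ∀ u, W 0 *ᵥ u = 0 → u = 0) :
    ∀ᶠ ε in 𝓝 (0 : ℝ), ∀ u, W ε *ᵥ u = 0 → u = 0 := by
  have hdet : ((W 0)ᵀ * W 0).det ≠ 0 := by
    intro h
    obtain ⟨v, hv, hv0⟩ := Matrix.exists_mulVec_eq_zero_iff.2 h
    refine hv (h0 v ?_)
    rw [← Matrix.mulVec_mulVec] at hv0
    rw [← dotProduct_self_eq_zero, Matrix.dotProduct_mulVec, ← Matrix.mulVec_transpose,
      hv0, zero_dotProduct]
  have hcont : Continuous fun ε => ((W ε)ᵀ * W ε).det :=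
    (hW.matrix_transpose.matrix_mul hW).matrix_det
  filter_upwards [hcont.continuousAt.eventually_ne hdet] with ε hε u hu
  by_contra hne
  exact hε (Matrix.exists_mulVec_eq_zero_iff.1 ⟨u, hne, by
    rw [← Matrix.mulVec_mulVec, hu, Matrix.mulVec_zero]⟩)

theorem exists_dotProduct_ne_zero {D : ℕ} {ι : Type*} [Finite ι] (c : ι → Fin D → ℝ)
    (hc : ∀ i, c i ≠ 0) : ∃ u : Fin D → ℝ, ∀ i, u ⬝ᵥ c i ≠ 0 := by
  obtain ⟨u, -, hu⟩ := exists_mem_open_forall_notMem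
    (fun i => ((dotProductBilin ℝ ℝ).flip (c i) : (Fin D → ℝ) →ₗ[ℝ] ℝ).ker) (fun i h => hc i <| by
      have : c i ∈ ((dotProductBilin ℝ ℝ).flip (c i) : (Fin D → ℝ) →ₗ[ℝ] ℝ).ker :=
        h ▸ Submodule.mem_top
      exact dotProduct_self_eq_zero.1 this) isOpen_univ Set.univ_nonempty
  exact ⟨u, hu⟩

/-- A small perturbation of the rows makes all labels strict at once. -/
theorem exists_strict_perturbation {N D : ℕ} (hD : 1 ≤ D) (K : ℕ)
    {V : Matrix (Fin N) (Fin D) ℝ} (hV : ∀ u, V *ᵥ u = 0 → u = 0) (τ : Equiv.Perm (Fin N)) :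
    ∃ W : Matrix (Fin N) (Fin D) ℝ, (∀ u, W *ᵥ u = 0 → u = 0) ∧
      ∀ I ∈ candidates V K τ, ∃ c, (∀ i ∈ I, 1 < |(W *ᵥ c) i|) ∧ ∀ j ∉ I, |(W *ᵥ c) j| < 1 := by
  classical
  choose φ hφ hI using fun I : candidates V K τ => I.2
  -- One direction orthogonal to none of the finitely many chosen points, so that the second-order
  -- term never vanishes.
  obtain ⟨u, hu⟩ := exists_dotProduct_ne_zero (fun I => polar (φ I))
    fun I => polar_ne_zero hD (φ I)
  -- Positive weights, larger for rows of higher priority.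
  let t : Fin N → ℝ := fun i => N - (τ i : ℕ)
  have ht : ∀ i, 0 < t i := fun i => sub_pos.2 (by exact_mod_cast (τ i).2)
  let W : ℝ → Matrix (Fin N) (Fin D) ℝ := fun ε =>
    Matrix.of fun i j => (1 + ε * t i) * V i j + ε ^ 2 * t i * u j
  have hWc : ∀ ε c i, (W ε *ᵥ c) i = (1 + ε * t i) * (V *ᵥ c) i + ε ^ 2 * t i * (u ⬝ᵥ c) := by
    intro ε c i
    simp only [W, Matrix.mulVec, dotProduct, Matrix.of_apply, Finset.mul_sum,
      ← Finset.sum_add_distrib]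
    exact Finset.sum_congr rfl fun j _ => by ring
  have hWcont : Continuous W := continuous_matrix fun i j => by
    simp only [W, Matrix.of_apply]; fun_prop
  have hW0 : W 0 = V := by ext i j; simp [W]
  have e1 : ∀ᶠ ε in 𝓝[>] (0 : ℝ), ∀ u, W ε *ᵥ u = 0 → u = 0 :=
    nhdsWithin_le_nhds (eventually_mulVec_injective hWcont (by rwa [hW0]))
  have e2 : ∀ᶠ ε in 𝓝[>] (0 : ℝ), ∀ (I : candidates V K τ) (i : Fin N) (j : Fin N), i ∈ I.1 →
      j ∉ I.1 → |(W ε *ᵥ polar (φ I)) j| < |(W ε *ᵥ polar (φ I)) i| := by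
    simp only [eventually_all, hWc]
    intro I i j hi hj
    refine eventually_abs_lt (ht j).le (hu I) ?_
    rcases ((isTopSet_iff.1 (hI I).1).2 i hi j hj).lt_or_eq with h | h
    · exact Or.inl h
    · refine Or.inr ⟨h, sub_lt_sub_left ?_ _⟩
      exact_mod_cast (hI I).2 i hi j hj h.symm
  have e3 : ∀ᶠ ε in 𝓝[>] (0 : ℝ), ∀ (I : candidates V K τ) (i : Fin N),
      0 < |(W ε *ᵥ polar (φ I)) i| := by
    simp only [eventually_all, hWc]
    intro I i
    have := eventually_abs_lt (x := 0) (y := (V *ᵥ polar (φ I)) i) (s := 0) (t := t i) le_rfl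
      (hu I) (by
        rw [abs_zero]
        exact (abs_nonneg _).lt_or_eq.imp_right fun h => ⟨h, ht i⟩)
    simpa using this
  obtain ⟨ε, h1, h2, h3⟩ := (e1.and (e2.and e3)).exists
  refine ⟨W ε, h1, fun I hIc => ?_⟩
  let w : Fin N → ℝ := fun i => |(W ε *ᵥ polar (φ ⟨I, hIc⟩)) i|
  -- Including `0` among the lower values makes `θ` positive even if `I` contains every index;
  -- dividing by `θ` moves the threshold to `1`.
  obtain ⟨θ, hlo, hhi⟩ := Order.exists_between_finsets (lo := insert 0 (Iᶜ.image w)) (hi := I.image w) (by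
    intro x hx y hy
    obtain ⟨i, hi, rfl⟩ := Finset.mem_image.1 hy
    rcases Finset.mem_insert.1 hx with rfl | hx
    · exact h3 ⟨I, hIc⟩ i
    · obtain ⟨j, hj, rfl⟩ := Finset.mem_image.1 hx
      exact h2 ⟨I, hIc⟩ i j hi (Finset.mem_compl.1 hj))
  have hθ : 0 < θ := hlo 0 (Finset.mem_insert_self _ _)
  refine ⟨θ⁻¹ • polar (φ ⟨I, hIc⟩), fun i hi => ?_, fun j hj => ?_⟩
  · rw [Matrix.mulVec_smul, Pi.smul_apply, smul_eq_mul, abs_mul, abs_of_pos (inv_pos.2 hθ),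
      lt_inv_mul_iff₀ hθ, mul_one]
    exact hhi _ (Finset.mem_image_of_mem w hi)
  · rw [Matrix.mulVec_smul, Pi.smul_apply, smul_eq_mul, abs_mul, abs_of_pos (inv_pos.2 hθ),
      inv_mul_lt_iff₀ hθ, mul_one]
    exact hlo _ (Finset.mem_insert_of_mem (Finset.mem_image_of_mem w (Finset.mem_compl.2 hj)))

theorem ncard_candidates_le {N D : ℕ} (hD : 1 ≤ D) (K : ℕ) {V : Matrix (Fin N) (Fin D) ℝ}
    (hV : V.rank = D) (τ : Equiv.Perm (Fin N)) :
    (candidates V K τ).ncard ≤ candidateBound N D := by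
  obtain ⟨W, hW, hsep⟩ := exists_strict_perturbation hD K (mulVec_injective_of_rank hV) τ
  choose c hc1 hc2 using fun I : candidates V K τ => hsep I.1 I.2
  -- The levels still strictly separated by the same points form an open set around the constant
  -- `1`, so generic levels can be taken from it.
  let U : Set (Fin N → ℝ) := {r | (∀ i, 0 < r i) ∧ ∀ (I : candidates V K τ) (i : Fin N),
    (i ∈ I.1 → r i < |(W *ᵥ c I) i|) ∧ (i ∉ I.1 → |(W *ᵥ c I) i| < r i)}
  have hU : IsOpen U := by
    simp only [U, Set.ofPred_and, Set.ofPred_forall]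
    refine (isOpen_iInter_of_finite fun i => isOpen_lt continuous_const (by fun_prop)).inter
      (isOpen_iInter_of_finite fun I => isOpen_iInter_of_finite fun i => ?_)
    exact (isOpen_iInter_of_finite fun _ => isOpen_lt (by fun_prop) continuous_const).inter
      (isOpen_iInter_of_finite fun _ => isOpen_lt continuous_const (by fun_prop))
  obtain ⟨r, ⟨hr, hrI⟩, hgen⟩ := exists_genericLevels W hU
    ⟨fun _ => 1, fun _ => one_pos, fun I i => ⟨hc1 I i, hc2 I i⟩⟩
  refine (ncard_separated_le hD K hW hr hgen _ fun I hI => ⟨?_, c ⟨I, hI⟩, ?_, ?_⟩).trans ?_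
  · obtain ⟨φ, -, h⟩ := hI
    exact h.1.1
  · exact fun i hi => ((hrI ⟨I, hI⟩ i).1 hi).le
  · exact fun j hj => ((hrI ⟨I, hI⟩ j).2 hj).le
  · exact Finset.single_le_sum (f := fun d => N.choose (D - 2 * d) *
      (D - 2 * d).choose (D / 2 - d) * 2 ^ (D - 1 - 2 * d)) (fun _ _ => Nat.zero_le _)
      (Finset.mem_range.2 (Nat.succ_pos _))

/-! ### Optimal vectors and their scores. -/

theorem mem_supp {N : ℕ} {x : EuclideanSpace ℝ (Fin N)} {i : Fin N} : i ∈ supp x ↔ x i ≠ 0 := by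
  simp [supp]

theorem norm_eq_one_iff_dotProduct {N : ℕ} (x : EuclideanSpace ℝ (Fin N)) :
    ‖x‖ = 1 ↔ x.ofLp ⬝ᵥ x.ofLp = 1 := by
  have h : x.ofLp ⬝ᵥ x.ofLp = ‖x‖ ^ 2 := by
    rw [EuclideanSpace.real_norm_sq_eq, dotProduct]
    exact Finset.sum_congr rfl fun i _ => (sq _).symm
  rw [h, pow_eq_one_iff_of_nonneg (norm_nonneg x) two_ne_zero]

theorem dotProduct_smul_one_add_mul_transpose {N D : ℕ} (V : Matrix (Fin N) (Fin D) ℝ) (s : ℝ)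
    (y : Fin N → ℝ) :
    y ⬝ᵥ ((s • (1 : Matrix (Fin N) (Fin N) ℝ) + V * Vᵀ) *ᵥ y) =
      s * (y ⬝ᵥ y) + (Vᵀ *ᵥ y) ⬝ᵥ (Vᵀ *ᵥ y) := by
  rw [Matrix.add_mulVec, Matrix.smul_mulVec, Matrix.one_mulVec, dotProduct_add, dotProduct_smul,
    smul_eq_mul, ← Matrix.mulVec_mulVec, Matrix.dotProduct_mulVec y V, ← Matrix.mulVec_transpose]

/-- The vector `w` with the entries outside of `T` replaced by zero. -/
def restrict {N : ℕ} (w : Fin N → ℝ) (T : Finset (Fin N)) : Fin N → ℝ :=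
  fun i => if i ∈ T then w i else 0

theorem supp_restrict_subset {N : ℕ} (w : Fin N → ℝ) (T : Finset (Fin N)) :
    supp (WithLp.toLp 2 (restrict w T)) ⊆ T := by
  intro i hi
  by_contra h
  exact mem_supp.1 hi (if_neg h)

theorem restrict_dotProduct {N : ℕ} (w y : Fin N → ℝ) (T : Finset (Fin N)) :
    restrict w T ⬝ᵥ y = ∑ i ∈ T, w i * y i := by
  simp [restrict, dotProduct, ite_mul, Finset.sum_ite_mem]

theorem restrict_dotProduct_self {N : ℕ} (w : Fin N → ℝ) (T : Finset (Fin N)) :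
    restrict w T ⬝ᵥ restrict w T = ∑ i ∈ T, w i ^ 2 := by
  rw [restrict_dotProduct]
  exact Finset.sum_congr rfl fun i hi => by rw [restrict, if_pos hi, sq]

section Optimal

variable {N D K : ℕ} {V : Matrix (Fin N) (Fin D) ℝ} {s : ℝ} {x : EuclideanSpace ℝ (Fin N)}

theorem IsSparsePC.dotProduct_self
    (hx : IsSparsePC (s • (1 : Matrix (Fin N) (Fin N) ℝ) + V * Vᵀ) K x) :
    x.ofLp ⬝ᵥ x.ofLp = 1 :=
  (norm_eq_one_iff_dotProduct x).1 hx.1.1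

/-- Normalizing `y` keeps it sparse, and the multiple of the identity contributes the same amount to
all unit vectors. The homogeneous form lets unnormalized test vectors be used. -/
theorem IsSparsePC.quadratic_le
    (hx : IsSparsePC (s • (1 : Matrix (Fin N) (Fin N) ℝ) + V * Vᵀ) K x) (y : Fin N → ℝ)
    (hy : (supp (WithLp.toLp 2 y)).card ≤ K) :
    (Vᵀ *ᵥ y) ⬝ᵥ (Vᵀ *ᵥ y) ≤ ((Vᵀ *ᵥ x.ofLp) ⬝ᵥ (Vᵀ *ᵥ x.ofLp)) * (y ⬝ᵥ y) := by
  by_cases h0 : y = 0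
  · simp [h0]
  have hpos : 0 < y ⬝ᵥ y :=
    lt_of_le_of_ne (by simpa using dotProduct_star_self_nonneg y)
      fun h => h0 (dotProduct_self_eq_zero.1 h.symm)
  set a := (Real.sqrt (y ⬝ᵥ y))⁻¹ with ha
  have haa : a * a * (y ⬝ᵥ y) = 1 := by
    rw [ha, ← mul_inv, Real.mul_self_sqrt hpos.le, inv_mul_cancel₀ hpos.ne']
  have hyy : (a • y) ⬝ᵥ (a • y) = 1 := by
    rw [smul_dotProduct, dotProduct_smul, smul_eq_mul, smul_eq_mul, ← mul_assoc, haa]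
  have hsub : supp (WithLp.toLp 2 (a • y)) ⊆ supp (WithLp.toLp 2 y) := by
    intro i hi
    rw [mem_supp] at hi ⊢
    intro h
    exact hi (by change a * y i = 0; rw [show y i = 0 from h, mul_zero])
  have := hx.2 (WithLp.toLp 2 (a • y))
    ⟨(norm_eq_one_iff_dotProduct _).2 hyy, (Finset.card_le_card hsub).trans hy⟩
  simp only [dotProduct_smul_one_add_mul_transpose, hx.dotProduct_self, Matrix.mulVec_smul,
    smul_dotProduct, dotProduct_smul, smul_eq_mul] at this
  have hle : a * a * ((Vᵀ *ᵥ y) ⬝ᵥ (Vᵀ *ᵥ y)) ≤ (Vᵀ *ᵥ x.ofLp) ⬝ᵥ (Vᵀ *ᵥ x.ofLp) := by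
    rw [← mul_assoc, mul_add, mul_left_comm, haa] at this
    linarith
  calc (Vᵀ *ᵥ y) ⬝ᵥ (Vᵀ *ᵥ y) = a * a * ((Vᵀ *ᵥ y) ⬝ᵥ (Vᵀ *ᵥ y)) * (y ⬝ᵥ y) := by
        rw [mul_right_comm, haa, one_mul]
    _ ≤ _ := mul_le_mul_of_nonneg_right hle hpos.le

/-- Otherwise testing on the coordinate vectors makes every row of `V` zero, which contradicts
injectivity as `D ≥ 1`. -/
theorem IsSparsePC.pos (hx : IsSparsePC (s • (1 : Matrix (Fin N) (Fin N) ℝ) + V * Vᵀ) K x)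
    (hD : 1 ≤ D) (hK : 1 ≤ K) (hV : ∀ u, V *ᵥ u = 0 → u = 0) :
    0 < (Vᵀ *ᵥ x.ofLp) ⬝ᵥ (Vᵀ *ᵥ x.ofLp) := by
  refine lt_of_le_of_ne (by simpa using dotProduct_star_self_nonneg (Vᵀ *ᵥ x.ofLp)) fun h => ?_
  have hrow : ∀ i, V i = 0 := by
    intro i
    have h1 := hx.quadratic_le (Pi.single i 1) (by
      refine (Finset.card_le_card (t := {i}) fun j hj => ?_).trans (by simpa using hK)
      rw [mem_supp] at hj
      by_contra hji
      exact hj (Pi.single_eq_of_ne (by simpa using hji) _))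
    rw [← h, zero_mul, Matrix.mulVec_single_one] at h1
    have h2 : (Vᵀ).col i = V i := rfl
    rw [h2] at h1
    exact dotProduct_self_eq_zero.1
      (le_antisymm h1 (by simpa using dotProduct_star_self_nonneg (V i)))
  have h1 : (fun _ : Fin D => (1 : ℝ)) = 0 := hV _ (funext fun i => by
    simp [Matrix.mulVec, hrow i])
  exact one_ne_zero (congrFun h1 ⟨0, hD⟩)

/-- The score of the rows in the direction of an optimal vector. -/
def score (V : Matrix (Fin N) (Fin D) ℝ) (x : EuclideanSpace ℝ (Fin N)) : Fin N → ℝ :=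
  V *ᵥ (Vᵀ *ᵥ x.ofLp)

theorem dotProduct_score (y : Fin N → ℝ) :
    y ⬝ᵥ score V x = (Vᵀ *ᵥ y) ⬝ᵥ (Vᵀ *ᵥ x.ofLp) := by
  rw [score, Matrix.dotProduct_mulVec, Matrix.mulVec_transpose V y]

theorem restrict_dotProduct_score (T : Finset (Fin N)) :
    (Vᵀ *ᵥ restrict (score V x) T) ⬝ᵥ (Vᵀ *ᵥ x.ofLp) = ∑ i ∈ T, score V x i ^ 2 := by
  rw [← dotProduct_score, restrict_dotProduct]
  exact Finset.sum_congr rfl fun i _ => (sq _).symm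

/-- With `z = Vᵀ(w|_T)` and `q = ∑_T w²`, optimality gives `‖z‖² ≤ Mq`, while `z · b = q`. Hence `0
≤ ‖z - Mb‖² ≤ M³ - Mq`. -/
theorem IsSparsePC.sum_sq_le
    (hx : IsSparsePC (s • (1 : Matrix (Fin N) (Fin N) ℝ) + V * Vᵀ) K x)
    (hM : 0 < (Vᵀ *ᵥ x.ofLp) ⬝ᵥ (Vᵀ *ᵥ x.ofLp)) {T : Finset (Fin N)} (hT : T.card ≤ K) :
    ∑ i ∈ T, score V x i ^ 2 ≤ ((Vᵀ *ᵥ x.ofLp) ⬝ᵥ (Vᵀ *ᵥ x.ofLp)) ^ 2 ∧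
      (∑ i ∈ T, score V x i ^ 2 = ((Vᵀ *ᵥ x.ofLp) ⬝ᵥ (Vᵀ *ᵥ x.ofLp)) ^ 2 →
        Vᵀ *ᵥ restrict (score V x) T = ((Vᵀ *ᵥ x.ofLp) ⬝ᵥ (Vᵀ *ᵥ x.ofLp)) • (Vᵀ *ᵥ x.ofLp)) := by
  have h1 := hx.quadratic_le (restrict (score V x) T)
    ((Finset.card_le_card (supp_restrict_subset _ _)).trans hT)
  have h2 := restrict_dotProduct_score (V := V) (x := x) T
  rw [restrict_dotProduct_self] at h1
  set b := Vᵀ *ᵥ x.ofLp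
  set M := b ⬝ᵥ b with hMdef
  set z := Vᵀ *ᵥ restrict (score V x) T
  set q := ∑ i ∈ T, score V x i ^ 2
  have h3 : (z - M • b) ⬝ᵥ (z - M • b) = z ⬝ᵥ z - 2 * M * q + M ^ 3 := by
    simp only [sub_dotProduct, dotProduct_sub, smul_dotProduct, dotProduct_smul, smul_eq_mul,
      dotProduct_comm b z, h2, ← hMdef]
    ring
  have h4 : 0 ≤ (z - M • b) ⬝ᵥ (z - M • b) := by
    simpa using dotProduct_star_self_nonneg (z - M • b)
  refine ⟨?_, fun hq => ?_⟩
  · have : M * q ≤ M * M ^ 2 := by nlinarith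
    exact le_of_mul_le_mul_left this hM
  · refine sub_eq_zero.1 (dotProduct_self_eq_zero.1 (le_antisymm ?_ h4))
    rw [h3]
    rw [hq] at h1 ⊢
    nlinarith

/-- On `S = supp x` one has `‖Mx - w|_S‖² = ∑_S w² - M²`, which is nonnegative as a norm and
nonpositive by `IsSparsePC.sum_sq_le`. -/
theorem IsSparsePC.smul_eq_restrict_score
    (hx : IsSparsePC (s • (1 : Matrix (Fin N) (Fin N) ℝ) + V * Vᵀ) K x)
    (hM : 0 < (Vᵀ *ᵥ x.ofLp) ⬝ᵥ (Vᵀ *ᵥ x.ofLp)) :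
    ((Vᵀ *ᵥ x.ofLp) ⬝ᵥ (Vᵀ *ᵥ x.ofLp)) • x.ofLp = restrict (score V x) (supp x) ∧
      ∑ i ∈ supp x, score V x i ^ 2 = ((Vᵀ *ᵥ x.ofLp) ⬝ᵥ (Vᵀ *ᵥ x.ofLp)) ^ 2 := by
  have h1 := (hx.sum_sq_le hM hx.1.2).1
  have h2 : restrict (score V x) (supp x) ⬝ᵥ x.ofLp = (Vᵀ *ᵥ x.ofLp) ⬝ᵥ (Vᵀ *ᵥ x.ofLp) := by
    rw [← dotProduct_score, dotProduct_comm x.ofLp, restrict_dotProduct, dotProduct]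
    refine Finset.sum_subset (Finset.subset_univ _) fun i _ hi => ?_
    rw [show x.ofLp i = 0 from not_not.1 fun h => hi (mem_supp.2 h), mul_zero]
  have h3 := restrict_dotProduct_self (score V x) (supp x)
  have hxx := hx.dotProduct_self
  set M := (Vᵀ *ᵥ x.ofLp) ⬝ᵥ (Vᵀ *ᵥ x.ofLp)
  set z := restrict (score V x) (supp x)
  set q := ∑ i ∈ supp x, score V x i ^ 2
  have h4 : (M • x.ofLp - z) ⬝ᵥ (M • x.ofLp - z) = q - M ^ 2 := by
    simp only [sub_dotProduct, dotProduct_sub, smul_dotProduct, dotProduct_smul, smul_eq_mul,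
      dotProduct_comm x.ofLp z, h2, h3, hxx]
    ring
  have h5 : 0 ≤ (M • x.ofLp - z) ⬝ᵥ (M • x.ofLp - z) := by
    simpa using dotProduct_star_self_nonneg (M • x.ofLp - z)
  have h6 : q = M ^ 2 := le_antisymm h1 (by linarith)
  exact ⟨sub_eq_zero.1 (dotProduct_self_eq_zero.1 (by rw [h4, h6, sub_self])), h6⟩

theorem exists_superset_sum_sq (hK : K ≤ N)
    (hx : IsSparsePC (s • (1 : Matrix (Fin N) (Fin N) ℝ) + V * Vᵀ) K x)
    (hM : 0 < (Vᵀ *ᵥ x.ofLp) ⬝ᵥ (Vᵀ *ᵥ x.ofLp)) :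
    ∃ I, supp x ⊆ I ∧ I.card = K ∧
      ∑ i ∈ I, score V x i ^ 2 = ((Vᵀ *ᵥ x.ofLp) ⬝ᵥ (Vᵀ *ᵥ x.ofLp)) ^ 2 := by
  obtain ⟨I, hSI, hI⟩ := Finset.exists_superset_card_eq hx.1.2 (by simpa using hK)
  refine ⟨I, hSI, hI, le_antisymm (hx.sum_sq_le hM hI.le).1 ?_⟩
  rw [← (hx.smul_eq_restrict_score hM).2]
  exact Finset.sum_le_sum_of_subset_of_nonneg hSI fun _ _ _ => sq_nonneg _

/-- Top sets in the direction of an optimal vector, in terms of its score. -/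
theorem IsSparsePC.isTopSet_iff_sum_sq (hK : K ≤ N)
    (hx : IsSparsePC (s • (1 : Matrix (Fin N) (Fin N) ℝ) + V * Vᵀ) K x)
    (hM : 0 < (Vᵀ *ᵥ x.ofLp) ⬝ᵥ (Vᵀ *ᵥ x.ofLp)) {φ : Fin (D - 1) → ℝ} {a : ℝ} (ha : a ≠ 0)
    (hφ : Vᵀ *ᵥ x.ofLp = a • polar φ) {I : Finset (Fin N)} (hI : I.card = K) :
    IsTopSet V K φ I ↔
      ∑ i ∈ I, score V x i ^ 2 = ((Vᵀ *ᵥ x.ofLp) ⬝ᵥ (Vᵀ *ᵥ x.ofLp)) ^ 2 := by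
  have hw : ∀ i, score V x i = a * (V *ᵥ polar φ) i := fun i => by
    rw [score, hφ, Matrix.mulVec_smul, Pi.smul_apply, smul_eq_mul]
  have hle : ∀ i j, |(V *ᵥ polar φ) j| ≤ |(V *ᵥ polar φ) i| ↔
      score V x j ^ 2 ≤ score V x i ^ 2 := fun i j => by
    rw [sq_le_sq, hw, hw, abs_mul, abs_mul, mul_le_mul_iff_right₀ (abs_pos.2 ha)]
  rw [isTopSet_iff]
  simp only [hle, hI, true_and]
  constructor
  · intro h
    obtain ⟨J, -, hJ, hJs⟩ := exists_superset_sum_sq hK hx hM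
    refine le_antisymm (hx.sum_sq_le hM hI.le).1 ?_
    rw [← hJs]
    exact sum_le_sum_of_exchange _ h (hJ.trans hI.symm)
  · intro h i hi j hj
    obtain ⟨h1, h2⟩ := sum_swap (fun k => score V x k ^ 2) I hi hj
    have := (hx.sum_sq_le hM (h1.trans hI).le).1
    linarith

theorem IsSparsePC.exists_subset_isTopSet (hK : K ≤ N)
    (hx : IsSparsePC (s • (1 : Matrix (Fin N) (Fin N) ℝ) + V * Vᵀ) K x)
    (hM : 0 < (Vᵀ *ᵥ x.ofLp) ⬝ᵥ (Vᵀ *ᵥ x.ofLp)) {φ : Fin (D - 1) → ℝ} {a : ℝ} (ha : a ≠ 0)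
    (hφ : Vᵀ *ᵥ x.ofLp = a • polar φ) : ∃ I, IsTopSet V K φ I ∧ supp x ⊆ I := by
  obtain ⟨I, hSI, hI, hsum⟩ := exists_superset_sum_sq hK hx hM
  exact ⟨I, (hx.isTopSet_iff_sum_sq hK hM ha hφ hI).2 hsum, hSI⟩

/-- A top set in the direction of an optimal vector supports an optimal vector. -/
theorem IsSparsePC.exists_isSparsePC_of_isTopSet (hK : K ≤ N)
    (hx : IsSparsePC (s • (1 : Matrix (Fin N) (Fin N) ℝ) + V * Vᵀ) K x)
    (hM : 0 < (Vᵀ *ᵥ x.ofLp) ⬝ᵥ (Vᵀ *ᵥ x.ofLp)) {φ : Fin (D - 1) → ℝ} {a : ℝ} (ha : a ≠ 0)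
    (hφ : Vᵀ *ᵥ x.ofLp = a • polar φ) {I : Finset (Fin N)} (hI : IsTopSet V K φ I) :
    ∃ y, IsSparsePC (s • (1 : Matrix (Fin N) (Fin N) ℝ) + V * Vᵀ) K y ∧ supp y ⊆ I := by
  have hsum := (hx.isTopSet_iff_sum_sq hK hM ha hφ hI.1).1 hI
  have hz := (hx.sum_sq_le hM hI.1.le).2 hsum
  have hself := restrict_dotProduct_self (score V x) I
  rw [hsum] at hself
  have hopt := fun y hy => hx.2 y hy
  simp only [dotProduct_smul_one_add_mul_transpose,
    hx.dotProduct_self] at hopt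
  set M := (Vᵀ *ᵥ x.ofLp) ⬝ᵥ (Vᵀ *ᵥ x.ofLp) with hMdef
  set z := restrict (score V x) I with hzdef
  have hsub : supp (WithLp.toLp 2 (M⁻¹ • z)) ⊆ I := by
    intro i hi
    rw [mem_supp] at hi
    by_contra h
    exact hi (by change M⁻¹ * z i = 0; rw [hzdef, restrict, if_neg h, mul_zero])
  have hunit : (M⁻¹ • z) ⬝ᵥ (M⁻¹ • z) = 1 := by
    rw [smul_dotProduct, dotProduct_smul, hself, smul_eq_mul, smul_eq_mul]
    field_simp
  have hVz : Vᵀ *ᵥ (M⁻¹ • z) = Vᵀ *ᵥ x.ofLp := by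
    rw [Matrix.mulVec_smul, hz, smul_smul, inv_mul_cancel₀ hM.ne', one_smul]
  refine ⟨WithLp.toLp 2 (M⁻¹ • z), ⟨⟨(norm_eq_one_iff_dotProduct _).2 hunit,
    (Finset.card_le_card hsub).trans hI.1.le⟩, fun y hy => ?_⟩, hsub⟩
  rw [dotProduct_smul_one_add_mul_transpose, dotProduct_smul_one_add_mul_transpose]
  change _ ≤ s * ((M⁻¹ • z) ⬝ᵥ (M⁻¹ • z)) + (Vᵀ *ᵥ (M⁻¹ • z)) ⬝ᵥ (Vᵀ *ᵥ (M⁻¹ • z))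
  rw [hunit, hVz]
  exact hopt y hy

/-- If no two rows agree up to sign, then every top set in the direction of an optimal vector
contains its support. -/
theorem IsSparsePC.supp_subset_of_isTopSet (hK : K ≤ N)
    (hx : IsSparsePC (s • (1 : Matrix (Fin N) (Fin N) ℝ) + V * Vᵀ) K x)
    (hM : 0 < (Vᵀ *ᵥ x.ofLp) ⬝ᵥ (Vᵀ *ᵥ x.ofLp)) {φ : Fin (D - 1) → ℝ} {a : ℝ} (ha : a ≠ 0)
    (hφ : Vᵀ *ᵥ x.ofLp = a • polar φ) (hrows : ∀ i j, i ≠ j → V i ≠ V j ∧ V i ≠ -V j)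
    {I : Finset (Fin N)} (hI : IsTopSet V K φ I) : supp x ⊆ I := by
  classical
  by_contra hnot
  obtain ⟨i, hiS, hiI⟩ := Finset.not_subset.1 hnot
  obtain ⟨j, hjI, hjS⟩ : ∃ j ∈ I, j ∉ supp x := by
    by_contra! h
    have h1 := Finset.card_lt_card (Finset.ssubset_iff_of_subset h |>.2 ⟨i, hiS, hiI⟩)
    have := hx.1.2
    have := hI.1
    omega
  have hij : i ≠ j := fun h => hiI (h ▸ hjI)
  obtain ⟨hxS, hS⟩ := hx.smul_eq_restrict_score hM
  have hw : score V x i ≠ 0 := by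
    have := congrFun hxS i
    rw [restrict, if_pos hiS, Pi.smul_apply, smul_eq_mul] at this
    rw [← this]
    exact mul_ne_zero hM.ne' (mem_supp.1 hiS)
  -- Swapping `j` for `i` in `I` gives `w i ^ 2 ≤ w j ^ 2`, and swapping `i` for `j` in `supp x`
  -- gives the converse. So the swapped support also attains `M²`, its restricted score has the same
  -- image under `Vᵀ`, and subtracting leaves `w j • V j = w i • V i`.
  obtain ⟨hc1, hs1⟩ := sum_swap (fun k => score V x k ^ 2) I hjI hiI
  obtain ⟨hc2, hs2⟩ := sum_swap (fun k => score V x k ^ 2) (supp x) hiS hjS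
  rw [(hx.isTopSet_iff_sum_sq hK hM ha hφ hI.1).1 hI] at hs1
  rw [hS] at hs2
  have hb1 := (hx.sum_sq_le hM (hc1.trans hI.1).le).1
  obtain ⟨hb2, heq⟩ := hx.sum_sq_le hM (hc2.trans_le hx.1.2)
  have hsq : score V x i ^ 2 = score V x j ^ 2 := by linarith
  have hV1 := heq (by rw [hs2, hsq]; ring)
  rw [← (hx.sum_sq_le hM hx.1.2).2 hS] at hV1
  have hdiff : restrict (score V x) (insert j ((supp x).erase i)) - restrict (score V x) (supp x) =
      Pi.single j (score V x j) - Pi.single i (score V x i) := by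
    ext k
    by_cases hki : k = i
    · subst hki
      simp [restrict, hiS, hij]
    · by_cases hkj : k = j
      · subst hkj
        simp [restrict, hjS, hki]
      · simp [restrict, hki, hkj]
  have hzero : Vᵀ *ᵥ (Pi.single j (score V x j) - Pi.single i (score V x i)) = 0 := by
    rw [← hdiff, Matrix.mulVec_sub, hV1, sub_self]
  rw [Matrix.mulVec_sub, sub_eq_zero] at hzero
  have hrow : ∀ k, V j k * score V x j = V i k * score V x i := fun k => by
    simpa using congrFun hzero k
  rcases sq_eq_sq_iff_eq_or_eq_neg.1 hsq with h | h
  · refine (hrows i j hij).1 (funext fun k => mul_right_cancel₀ hw ?_)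
    rw [← hrow k, h]
  · refine (hrows i j hij).2 (funext fun k => mul_right_cancel₀ hw ?_)
    rw [← hrow k, h, Pi.neg_apply]
    ring

end Optimal

/-! ### Existence of an optimum, growth of the bound, and conclusion. -/

/-- The sparse vectors form a finite union of coordinate subspaces, so the sparse sphere is compact.
-/
theorem exists_isSparsePC {N K : ℕ} (hK : 1 ≤ K) (hKN : K ≤ N) (C : Matrix (Fin N) (Fin N) ℝ) :
    ∃ x, IsSparsePC C K x := by
  have hclosed : IsClosed {x : EuclideanSpace ℝ (Fin N) | (supp x).card ≤ K} := by
    have : {x : EuclideanSpace ℝ (Fin N) | (supp x).card ≤ K} =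
        ⋃ T : {T : Finset (Fin N) // T.card ≤ K}, {x | ∀ i, i ∉ T.1 → x i = 0} := by
      ext x
      simp only [Set.mem_ofPred_eq, Set.mem_iUnion]
      constructor
      · exact fun h => ⟨⟨supp x, h⟩, fun i hi => not_not.1 fun h' => hi (mem_supp.2 h')⟩
      · rintro ⟨T, hT⟩
        refine (Finset.card_le_card fun i hi => ?_).trans T.2
        by_contra hiT
        exact mem_supp.1 hi (hT i hiT)
    rw [this]
    refine isClosed_iUnion_of_finite fun T => ?_
    simp only [Set.ofPred_forall]
    exact isClosed_iInter fun i => isClosed_iInter fun _ =>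
      isClosed_eq (by fun_prop) continuous_const
  have hcompact : IsCompact (sparseSphere N K) := by
    have : sparseSphere N K =
        Metric.sphere (0 : EuclideanSpace ℝ (Fin N)) 1 ∩ {x | (supp x).card ≤ K} := by
      ext x; simp [sparseSphere]
    rw [this]
    exact (isCompact_sphere (0 : EuclideanSpace ℝ (Fin N)) 1).inter_right hclosed
  have hne : (sparseSphere N K).Nonempty := by
    refine ⟨EuclideanSpace.single ⟨0, by omega⟩ 1, by simp, ?_⟩
    refine (Finset.card_le_card (t := {⟨0, by omega⟩}) fun j hj => ?_).trans (by simpa using hK)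
    rw [mem_supp] at hj
    by_contra h
    exact hj (by simpa using h)
  obtain ⟨x, hx, hmax⟩ := hcompact.exists_isMaxOn (f := fun y : EuclideanSpace ℝ (Fin N) =>
    y.ofLp ⬝ᵥ (C *ᵥ y.ofLp)) hne (by
      refine Continuous.continuousOn ?_
      simp only [dotProduct, Matrix.mulVec]
      fun_prop)
  exact ⟨x, hx, fun y hy => hmax hy⟩

theorem candidateBound_isBigO (D : ℕ) :
    (fun N : ℕ => (candidateBound N D : ℝ)) =O[Filter.atTop] (fun N : ℕ => (N : ℝ) ^ D) := by
  have key : ∀ d : ℕ, (fun N : ℕ => ((N.choose (D - 2 * d) * (D - 2 * d).choose (D / 2 - d) *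
      2 ^ (D - 1 - 2 * d) : ℕ) : ℝ)) =O[Filter.atTop] (fun N : ℕ => (N : ℝ) ^ D) := by
    intro d
    refine Asymptotics.IsBigO.of_bound
      (((D - 2 * d).choose (D / 2 - d) * 2 ^ (D - 1 - 2 * d) : ℕ) : ℝ) ?_
    filter_upwards [Filter.eventually_ge_atTop 1] with N hN
    rw [Real.norm_of_nonneg (by positivity), Real.norm_of_nonneg (by positivity)]
    have h : N.choose (D - 2 * d) ≤ N ^ D :=
      (Nat.choose_le_pow _ _).trans (Nat.pow_le_pow_right hN (Nat.sub_le _ _))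
    have := Nat.mul_le_mul_right ((D - 2 * d).choose (D / 2 - d) * 2 ^ (D - 1 - 2 * d)) h
    rw [← mul_assoc, mul_comm (N ^ D)] at this
    exact_mod_cast this
  simp only [candidateBound, Nat.cast_sum]
  exact Asymptotics.IsBigO.fun_sum (s := Finset.range ((D - 1) / 2 + 1)) fun d _ => key d

end SparsePCA

open SparsePCA
theorem mainTheorem2 (D : ℕ) (hD : 1 ≤ D) :
    -- every instance: the candidate set catches the optimum and obeys the bound
    (∀ (N K : ℕ), 1 ≤ K → K ≤ N → ∀ (V : Matrix (Fin N) (Fin D) ℝ), V.rank = D →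
      ∀ (s : ℝ) (C : Matrix (Fin N) (Fin N) ℝ),
        C = s • (1 : Matrix (Fin N) (Fin N) ℝ) + V * Vᵀ →
        -- every optimal support is caught by a top-`K` set of some point
        (∀ x, IsSparsePC C K x → ∃ φ ∈ angles D, ∃ I, IsTopSet V K φ I ∧ supp x ⊆ I) ∧
        ∀ τ : Equiv.Perm (Fin N),
          -- the labels with ties broken by `τ` catch an optimal support
          (∃ x, IsSparsePC C K x ∧ ∃ I ∈ candidates V K τ, supp x ⊆ I) ∧
          -- and they catch all of them if no two rows agree up to sign
          ((∀ i j, i ≠ j → V i ≠ V j ∧ V i ≠ -V j) →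
            ∀ x, IsSparsePC C K x → ∃ I ∈ candidates V K τ, supp x ⊆ I) ∧
          (candidates V K τ).ncard ≤ candidateBound N D) ∧
    -- the bound is `O(N^D)` for fixed `D`
    (fun N : ℕ => (candidateBound N D : ℝ)) =O[Filter.atTop] (fun N : ℕ => (N : ℝ) ^ D) := by
  refine ⟨fun N K hK hKN V hV s C hC => ?_, candidateBound_isBigO D⟩
  subst hC
  have hinj := mulVec_injective_of_rank hV
  have hdir : ∀ x, IsSparsePC (s • (1 : Matrix (Fin N) (Fin N) ℝ) + V * Vᵀ) K x →
      ∃ φ ∈ angles D, ∃ a : ℝ, a ≠ 0 ∧ Vᵀ *ᵥ x.ofLp = a • polar φ := fun x hx =>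
    exists_eq_smul_polar hD _ fun h => (hx.pos hD hK hinj).ne' (by rw [h, zero_dotProduct])
  refine ⟨fun x hx => ?_, fun τ => ⟨?_, fun hrows x hx => ?_, ncard_candidates_le hD K hV τ⟩⟩
  · obtain ⟨φ, hφ, a, ha, hb⟩ := hdir x hx
    exact ⟨φ, hφ, hx.exists_subset_isTopSet hKN (hx.pos hD hK hinj) ha hb⟩
  · obtain ⟨x, hx⟩ := exists_isSparsePC hK hKN (s • (1 : Matrix (Fin N) (Fin N) ℝ) + V * Vᵀ)
    obtain ⟨φ, hφ, a, ha, hb⟩ := hdir x hx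
    obtain ⟨I, hI, -⟩ := existsUnique_isLabel hKN V τ φ
    obtain ⟨y, hy, hyI⟩ := hx.exists_isSparsePC_of_isTopSet hKN (hx.pos hD hK hinj) ha hb hI.1
    exact ⟨y, hy, I, ⟨φ, hφ, hI⟩, hyI⟩
  · obtain ⟨φ, hφ, a, ha, hb⟩ := hdir x hx
    obtain ⟨I, hI, -⟩ := existsUnique_isLabel hKN V τ φ
    exact ⟨I, ⟨φ, hφ, hI⟩, hx.supp_subset_of_isTopSet hKN (hx.pos hD hK hinj) ha hb hrows hI.1⟩
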